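/- Let $M$ be a separable II$_1$ factor (an infinite-dimensional von Neumann algebra with trivial center that admits a normal faithful tracial state $\operatorname{tr}$; separable means separable for the 2-norm $\|x\|_2=\operatorname{tr}(x^*x)^{1/2}$), let $N\subseteq M$ be a (unital) von Neumann subalgebra, and let $M_1$ be the operator-norm unit ball of $M$ with the metric $d$ given by $\|\cdot\|_2$. Write $[x,y]=xy-yx$, $N'\cap M=\{x\in M : xy=yx \text{ for all } y\in N\}$, $N'\cap M_1=(N'\cap M)\cap M_1$, let $U(N)$ be the unitary group of $N$, and let $\mathbb{E}_{N'\cap M}$ be the orthogonal projection of $L^2(M)$ onto $L^2(N'\cap M)$. We say that $N$ has weak spectral gap in $M$ if for every $\epsilon>0$ there are finitely many $u_1,\dots,u_n\in U(N)$ and $\delta>0$ such that, for all $x\in M_1$, $$\max_i\|[x,u_i]\|_2\le\delta\ \Longrightarrow\ \|x-\mathbb{E}_{N'\cap M}(x)\|_2\le\epsilon .$$ Let $(u_n)_{n\ge 0}$ be a sequence in $U(N)$ that is $\|\cdot\|_2$-dense in $U(N)$, and let $\varphi_N(x)=\sum_{n\ge 0}2^{-n}\|[x,u_n]\|_2$ for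 $x\in M_1$. This is a formula in $M$ over $N$, that is, a uniform limit on $M_1$ of interpretations of continuous-logic formulae in the language of tracial von Neumann algebras with parameters from $N$. For a formula $\varphi$ in $M$ over $N$ with free variable ranging over $M_1$ and with zero set $Z(\varphi)\subseteq M_1$, a set $X\subseteq M_1$ is called a $\varphi$-definable subset of $M_1$ if $X=Z(\varphi)$ and for every $\epsilon>0$ there is $\delta>0$ such that, for all $x\in M_1$, $\varphi(x)<\delta$ implies $d(x,X)\le\epsilon$. Theorem. $N$ has weak spectral gap in $M$ if and only if $N'\cap M_1$ is a $\varphi_N$-definable subset of $M_1$. -/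

import Mathlib

open scoped ComplexOrder

noncomputable section

namespace TracialVN

universe w

variable {H : Type w} [NormedAddCommGroup H] [InnerProductSpace ℂ H] [CompleteSpace H]

/-! ### Traces and II₁ factors -/

/-- A trace on a von Neumann algebra `M ⊆ B(H)`: a normalized, positive, faithful, normal
(WOT-continuous on the operator-norm unit ball), tracial linear functional. -/
structure Trace (M : VonNeumannAlgebra H) where
  toLin : M.toStarSubalgebra →ₗ[ℂ] ℂ
  map_one' : toLin 1 = 1
  nonneg' : ∀ x, 0 ≤ toLin (star x * x)
  faithful' : ∀ x, toLin (star x * x) = 0 ↔ x = 0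
  normal' : Continuous
    fun T : {T : H →WOT[ℂ] H // T.toCLM ∈ M.toStarSubalgebra ∧ ‖T.toCLM‖ ≤ 1} =>
      toLin ⟨T.1.toCLM, T.2.1⟩
  tracial' : ∀ x y, toLin (x * y) = toLin (y * x)

/-- A II₁ factor: an infinite-dimensional von Neumann algebra with trivial center that
admits a trace. -/
structure IsII1Factor (M : VonNeumannAlgebra H) : Prop where
  center_trivial : ∀ x ∈ M, (∀ y ∈ M, x * y = y * x) → ∃ c : ℂ, x = c • (1 : H →L[ℂ] H)
  infinite_dim : ¬ FiniteDimensional ℂ M.toStarSubalgebra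
  exists_trace : Nonempty (Trace M)

/-! ### The 2-norm and `L²(M)` -/

/-- The algebra `M`, as a type copy on which `‖·‖` is the 2-norm `‖x‖₂ = tr(x*x)^{1/2}` and the
metric is the associated one. The operator norm of `x` is written `opNorm x`. -/
def TwoNormed {M : VonNeumannAlgebra H} (_tr : Trace M) : Type w := M.toStarSubalgebra

section TwoNormed

variable {M : VonNeumannAlgebra H} (tr : Trace M)

instance : Ring (TwoNormed tr) := inferInstanceAs (Ring M.toStarSubalgebra)
instance : StarRing (TwoNormed tr) := inferInstanceAs (StarRing M.toStarSubalgebra)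
instance : Algebra ℂ (TwoNormed tr) := inferInstanceAs (Algebra ℂ M.toStarSubalgebra)
instance : StarModule ℂ (TwoNormed tr) := inferInstanceAs (StarModule ℂ M.toStarSubalgebra)

variable {tr}

/-- The underlying operator on `H`. -/
def op (x : TwoNormed tr) : H →L[ℂ] H := Subtype.val (p := fun y => y ∈ M.toStarSubalgebra) x

/-- The operator norm. -/
def opNorm (x : TwoNormed tr) : ℝ := ‖op x‖

/-- The trace, as a functional on the type copy. -/
def trL (tr : Trace M) : TwoNormed tr →ₗ[ℂ] ℂ := tr.toLin

lemma trL_nonneg (x : TwoNormed tr) : 0 ≤ trL tr (star x * x) := tr.nonneg' x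

lemma trL_symm (x y : TwoNormed tr) :
    (starRingEnd ℂ) (trL tr (star y * x)) = trL tr (star x * y) := by
  have im0 : ∀ z : TwoNormed tr, (trL tr (star z * z)).im = 0 := fun z =>
    ((Complex.nonneg_iff.1 (trL_nonneg z)).2).symm
  have h1 := im0 (x + y)
  have h2 := im0 (x + Complex.I • y)
  simp only [star_add, star_smul, add_mul, mul_add, map_add, Complex.add_im, smul_mul_assoc,
    mul_smul_comm, map_smul, smul_eq_mul, Complex.mul_im, Complex.mul_re, im0] at h1 h2
  simp at h1 h2
  apply Complex.ext
  · simp; linarith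
  · simp; linarith

/-- The inner product of `L²(M)` on `M`. (Following Mathlib, it is conjugate-linear in the first
variable: `⟪x, y⟫ = tr(x* y)`.) -/
@[reducible] def innerCore (tr : Trace M) : InnerProductSpace.Core ℂ (TwoNormed tr) where
  inner x y := trL tr (star x * y)
  conj_inner_symm x y := trL_symm x y
  re_inner_nonneg x := (Complex.nonneg_iff.1 (trL_nonneg x)).1
  add_left x y z := by simp [add_mul]
  smul_left x y r := by simp
  definite x hx := (tr.faithful' x).1 hx

instance : NormedAddCommGroup (TwoNormed tr) :=
  @InnerProductSpace.Core.toNormedAddCommGroup ℂ _ _ _ _ (innerCore tr)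

instance : InnerProductSpace ℂ (TwoNormed tr) :=
  InnerProductSpace.ofCore (innerCore tr).toCore

lemma inner_eq (x y : TwoNormed tr) : inner ℂ x y = trL tr (star x * y) := rfl

lemma norm_eq (x : TwoNormed tr) : ‖x‖ = √(trL tr (star x * x)).re := rfl

lemma exists_star_mul_self_eq {A : Type*} [CStarAlgebra A] (a : A) :
    ∃ b : A, ((‖a‖ ^ 2 : ℝ) : ℂ) • (1 : A) - star a * a = star b * b := by
  let _ : PartialOrder A := CStarAlgebra.spectralOrder A
  have _ : StarOrderedRing A := CStarAlgebra.spectralOrderedRing A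
  have h := CStarAlgebra.star_mul_le_algebraMap_norm_sq (a := a)
  rw [← sub_nonneg, CStarAlgebra.nonneg_iff_eq_star_mul_self] at h
  obtain ⟨b, hb⟩ := h
  exact ⟨b, by rw [← hb, Algebra.algebraMap_eq_smul_one]; rfl⟩

lemma isClosed_coe (M : VonNeumannAlgebra H) :
    IsClosed (M.toStarSubalgebra : Set (H →L[ℂ] H)) := by
  have h := M.centralizer_centralizer
  rw [VonNeumannAlgebra.coe_toStarSubalgebra, ← h]
  exact Set.isClosed_centralizer _

/-- `‖x‖₂ ≤ ‖x‖`. -/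
lemma norm_le_opNorm (x : TwoNormed tr) : ‖x‖ ≤ opNorm x := by
  let _ : CStarAlgebra M.toStarSubalgebra :=
    { toCompleteSpace := (isClosed_coe M).completeSpace_coe
      norm_mul_self_le := fun x =>
        (CStarRing.norm_star_mul_self (x := (x : H →L[ℂ] H))).symm.le }
  obtain ⟨b, hb⟩ := exists_star_mul_self_eq (A := M.toStarSubalgebra) x
  have h1 := tr.nonneg' b
  rw [← hb, map_sub, map_smul, tr.map_one', smul_eq_mul, mul_one] at h1
  have h3 := (Complex.nonneg_iff.1 h1).1
  rw [Complex.sub_re, Complex.ofReal_re, sub_nonneg] at h3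
  rw [norm_eq]
  exact Real.sqrt_le_iff.2 ⟨norm_nonneg _, h3⟩

end TwoNormed

variable {M : VonNeumannAlgebra H}

/-- The Hilbert space `L²(M)`: the completion of `M` for the 2-norm. -/
abbrev L2 (tr : Trace M) : Type w := UniformSpace.Completion (TwoNormed tr)

/-- `L²(Q)` for a linear subspace `Q` of `M`, as a closed subspace of `L²(M)`. -/
def L2Sub {tr : Trace M} (Q : Submodule ℂ (TwoNormed tr)) : Submodule ℂ (L2 tr) :=
  (Q.map (UniformSpace.Completion.toComplₗᵢ (𝕜 := ℂ) (E := TwoNormed tr)).toLinearMap).topologicalClosure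

instance {tr : Trace M} (Q : Submodule ℂ (TwoNormed tr)) : CompleteSpace (L2Sub Q) :=
  inferInstanceAs (CompleteSpace (Submodule.topologicalClosure _))

/-- The orthogonal projection `𝔼_Q` of `L²(M)` onto `L²(Q)`. -/
def condExp {tr : Trace M} (Q : Submodule ℂ (TwoNormed tr)) : L2 tr →L[ℂ] L2 tr :=
  (L2Sub Q).starProjection

/-! ### Relative commutants, unitaries, weak spectral gap -/

/-- The relative commutant `N' ∩ M`. -/
def relCommutant (tr : Trace M) (N : VonNeumannAlgebra H) : Submodule ℂ (TwoNormed tr) where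
  carrier := {x | ∀ y : TwoNormed tr, op y ∈ N → x * y = y * x}
  add_mem' hx hz y hy := by rw [add_mul, mul_add, hx y hy, hz y hy]
  zero_mem' y _ := by rw [zero_mul, mul_zero]
  smul_mem' c x hx y hy := by rw [smul_mul_assoc, mul_smul_comm, hx y hy]

/-- The unitary group `U(N)` (for `N ⊆ M`), as a subset of `M` with the 2-norm metric. -/
def unitaries (tr : Trace M) (N : VonNeumannAlgebra H) : Set (TwoNormed tr) :=
  {v | op v ∈ N ∧ star v * v = 1 ∧ v * star v = 1}

/-- `N` has weak spectral gap in `M`. -/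
def HasWeakSpectralGap (tr : Trace M) (N : VonNeumannAlgebra H) : Prop :=
  ∀ ε > (0 : ℝ), ∃ F : Finset (TwoNormed tr), (F : Set (TwoNormed tr)) ⊆ unitaries tr N ∧
    ∃ δ > (0 : ℝ), ∀ x : TwoNormed tr, opNorm x ≤ 1 →
      (∀ v ∈ F, ‖x * v - v * x‖ ≤ δ) →
        ‖(x : L2 tr) - condExp (relCommutant tr N) (x : L2 tr)‖ ≤ ε

/-! ### `M` as a metric structure: terms and formulae with parameters -/

/-- The sort of index `n`: the operator-norm ball of radius `n`, with the 2-norm metric. -/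
abbrev Sort' (tr : Trace M) (n : ℕ) : Type w := {x : TwoNormed tr // opNorm x ≤ n}

/-- Terms, with parameters from `A ⊆ M`, in free variables `x_i` (`i < k`) of sorts `s i`; the
index is the sort of the term. Scalar multiplication by `c` is a function symbol from the sort `m`
to every sort that contains the result; for `c = 1` these are the inclusions between sorts. -/
inductive Term {tr : Trace M} (A : Set (TwoNormed tr)) {k : ℕ} (s : Fin k → ℕ) : ℕ → Type w
  | var (i : Fin k) : Term A s (s i)
  | param {n : ℕ} (a : Sort' tr n) (ha : a.1 ∈ A) : Term A s n
  | zero (n : ℕ) : Term A s n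
  | one : Term A s 1
  | add {m n : ℕ} (t : Term A s m) (t' : Term A s n) : Term A s (m + n)
  | mul {m n : ℕ} (t : Term A s m) (t' : Term A s n) : Term A s (m * n)
  | smul {m n : ℕ} (c : ℂ) (h : ‖c‖ * m ≤ n) (t : Term A s m) : Term A s n
  | star {n : ℕ} (t : Term A s n) : Term A s n

/-- Formulae, with parameters from `A ⊆ M`: the atomic ones are the real and imaginary parts of
the trace and the metrics of the sorts; they are closed under all continuous connectives
`ℝᵐ → ℝ` and under `sup` and `inf` over a sort. -/
inductive Formula {tr : Trace M} (A : Set (TwoNormed tr)) : {k : ℕ} → (Fin k → ℕ) → Type w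
  | trRe {k : ℕ} {s : Fin k → ℕ} {n : ℕ} (t : Term A s n) : Formula A s
  | trIm {k : ℕ} {s : Fin k → ℕ} {n : ℕ} (t : Term A s n) : Formula A s
  | dist {k : ℕ} {s : Fin k → ℕ} {n : ℕ} (t t' : Term A s n) : Formula A s
  | conn {k : ℕ} {s : Fin k → ℕ} {m : ℕ} (f : C(Fin m → ℝ, ℝ)) (φ : Fin m → Formula A s) :
      Formula A s
  | sup {k : ℕ} {s : Fin k → ℕ} (n : ℕ) (φ : Formula A (Fin.cons n s : Fin (k + 1) → ℕ)) :
      Formula A s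
  | inf {k : ℕ} {s : Fin k → ℕ} (n : ℕ) (φ : Formula A (Fin.cons n s : Fin (k + 1) → ℕ)) :
      Formula A s

section interp

variable {tr : Trace M} {A : Set (TwoNormed tr)}

lemma opNorm_add (x y : TwoNormed tr) : opNorm (x + y) ≤ opNorm x + opNorm y :=
  norm_add_le (op x) (op y)

lemma opNorm_mul (x y : TwoNormed tr) : opNorm (x * y) ≤ opNorm x * opNorm y :=
  norm_mul_le (op x) (op y)

lemma opNorm_smul (c : ℂ) (x : TwoNormed tr) : opNorm (c • x) = ‖c‖ * opNorm x :=
  norm_smul c (op x)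

lemma opNorm_star (x : TwoNormed tr) : opNorm (star x) = opNorm x :=
  norm_star (op x)

lemma opNorm_zero : opNorm (0 : TwoNormed tr) = 0 := norm_zero (E := H →L[ℂ] H)

lemma opNorm_one : opNorm (1 : TwoNormed tr) ≤ 1 := ContinuousLinearMap.norm_id_le

lemma opNorm_nonneg (x : TwoNormed tr) : 0 ≤ opNorm x := norm_nonneg (op x)

/-- The interpretation of a term in `M`. -/
def Term.interp {k : ℕ} {s : Fin k → ℕ} (v : ∀ i, Sort' tr (s i)) :
    {n : ℕ} → Term A s n → Sort' tr n
  | _, .var i => v i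
  | _, .param a _ => a
  | _, .zero n => ⟨0, by rw [opNorm_zero]; positivity⟩
  | _, .one => ⟨1, by simpa using opNorm_one⟩
  | _, .add t t' => ⟨(t.interp v).1 + (t'.interp v).1, by
      push_cast
      exact (opNorm_add _ _).trans (add_le_add (t.interp v).2 (t'.interp v).2)⟩
  | _, .mul t t' => ⟨(t.interp v).1 * (t'.interp v).1, by
      push_cast
      exact (opNorm_mul _ _).trans
        (mul_le_mul (t.interp v).2 (t'.interp v).2 (opNorm_nonneg _) (Nat.cast_nonneg _))⟩
  | _, .smul c h t => ⟨c • (t.interp v).1, by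
      rw [opNorm_smul]
      exact (mul_le_mul_of_nonneg_left (t.interp v).2 (norm_nonneg c)).trans h⟩
  | _, .star t => ⟨Star.star (t.interp v).1, by rw [opNorm_star]; exact (t.interp v).2⟩

/-- The interpretation of a formula in `M`. -/
def Formula.interp : {k : ℕ} → {s : Fin k → ℕ} → Formula A s → (∀ i, Sort' tr (s i)) → ℝ
  | _, _, .trRe t, v => (trL tr (t.interp v).1).re
  | _, _, .trIm t, v => (trL tr (t.interp v).1).im
  | _, _, .dist t t', v => Dist.dist (t.interp v) (t'.interp v)
  | _, _, .conn f φ, v => f fun j => (φ j).interp v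
  | _, s, .sup n φ, v =>
      ⨆ x : Sort' tr n, φ.interp (Fin.cons (α := fun i => Sort' tr ((Fin.cons n s : _ → ℕ) i)) x v)
  | _, s, .inf n φ, v =>
      ⨅ x : Sort' tr n, φ.interp (Fin.cons (α := fun i => Sort' tr ((Fin.cons n s : _ → ℕ) i)) x v)

lemma abs_trL_le (x : TwoNormed tr) : ‖trL tr x‖ ≤ opNorm x := by
  have h := norm_inner_le_norm (𝕜 := ℂ) (1 : TwoNormed tr) x
  rw [inner_eq, star_one, one_mul] at h
  have h1 : ‖(1 : TwoNormed tr)‖ ≤ 1 := (norm_le_opNorm _).trans opNorm_one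
  calc _ ≤ ‖(1 : TwoNormed tr)‖ * ‖x‖ := h
    _ ≤ 1 * opNorm x := mul_le_mul h1 (norm_le_opNorm x) (norm_nonneg _) zero_le_one
    _ = _ := one_mul _

/-- Interpretations of formulae are bounded; in particular the `sup` and `inf` in them are
genuine suprema and infima. -/
lemma Formula.interp_bounded : ∀ {k : ℕ} {s : Fin k → ℕ} (φ : Formula A s),
    ∃ C : ℝ, ∀ v, |φ.interp v| ≤ C
  | _, _, .trRe (n := n) t => ⟨n, fun v =>
      (Complex.abs_re_le_norm _).trans ((abs_trL_le _).trans (t.interp v).2)⟩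
  | _, _, .trIm (n := n) t => ⟨n, fun v =>
      (Complex.abs_im_le_norm _).trans ((abs_trL_le _).trans (t.interp v).2)⟩
  | _, _, .dist (n := n) t t' => ⟨n + n, fun v => by
      rw [Formula.interp, abs_of_nonneg dist_nonneg, Subtype.dist_eq, dist_eq_norm]
      exact (norm_sub_le _ _).trans (add_le_add ((norm_le_opNorm _).trans (t.interp v).2)
        ((norm_le_opNorm _).trans (t'.interp v).2))⟩
  | _, _, .conn f φ => by
      choose C hC using fun j => (φ j).interp_bounded
      have hK : IsCompact (Set.univ.pi fun j => Set.Icc (-C j) (C j)) :=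
        isCompact_univ_pi fun j => isCompact_Icc
      obtain ⟨B, hB⟩ := hK.exists_bound_of_continuousOn f.continuous.continuousOn
      exact ⟨B, fun v => hB _ fun j _ => abs_le.1 (hC j v)⟩
  | _, _, .sup n φ => by
      obtain ⟨C, hC⟩ := φ.interp_bounded
      have : Nonempty (Sort' tr n) := ⟨⟨0, by rw [opNorm_zero]; positivity⟩⟩
      refine ⟨C, fun v => abs_le.2 ⟨?_, ciSup_le fun x => (abs_le.1 (hC _)).2⟩⟩
      exact le_ciSup_of_le ⟨C, by rintro _ ⟨x, rfl⟩; exact (abs_le.1 (hC _)).2⟩ this.some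
        (abs_le.1 (hC _)).1
  | _, _, .inf n φ => by
      obtain ⟨C, hC⟩ := φ.interp_bounded
      have : Nonempty (Sort' tr n) := ⟨⟨0, by rw [opNorm_zero]; positivity⟩⟩
      refine ⟨C, fun v => abs_le.2 ⟨le_ciInf fun x => (abs_le.1 (hC _)).1, ?_⟩⟩
      exact ciInf_le_of_le ⟨-C, by rintro _ ⟨x, rfl⟩; exact (abs_le.1 (hC _)).1⟩ this.some
        (abs_le.1 (hC _)).2

end interp

/-! ### Formulae in `M` over `A` and definability -/

/-- The valuation of a single free variable ranging over the operator-norm unit ball `M_1`. -/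
def val1 {tr : Trace M} (x : Sort' tr 1) : ∀ i : Fin 1, Sort' tr ((fun _ => 1 : Fin 1 → ℕ) i) :=
  fun _ => x

/-- A formula in `M` over `A` (in one free variable ranging over `M_1`): a sequence of formulae
with parameters from `A` whose interpretations are uniformly Cauchy in `M`. -/
structure FormulaIn {tr : Trace M} (A : Set (TwoNormed tr)) where
  seq : ℕ → Formula A (fun _ : Fin 1 => 1)
  cauchy : ∀ ε > (0 : ℝ), ∃ K : ℕ, ∀ m ≥ K, ∀ n ≥ K, ∀ x : Sort' tr 1,
    |(seq m).interp (val1 x) - (seq n).interp (val1 x)| ≤ ε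

/-- The interpretation in `M` of a formula in `M` over `A`: the limit of the interpretations. -/
def FormulaIn.interp {tr : Trace M} {A : Set (TwoNormed tr)} (φ : FormulaIn A)
    (x : Sort' tr 1) : ℝ :=
  Filter.limUnder Filter.atTop fun n => (φ.seq n).interp (val1 x)

lemma FormulaIn.tendsto_interp {tr : Trace M} {A : Set (TwoNormed tr)} (φ : FormulaIn A)
    (x : Sort' tr 1) :
    Filter.Tendsto (fun n => (φ.seq n).interp (val1 x)) Filter.atTop (nhds (φ.interp x)) := by
  refine CauchySeq.tendsto_limUnder (Metric.cauchySeq_iff.2 fun ε hε => ?_)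
  obtain ⟨K, hK⟩ := φ.cauchy (ε / 2) (half_pos hε)
  exact ⟨K, fun m hm n hn => (hK m hm n hn x).trans_lt (half_lt_self hε)⟩

/-- The zero set of a formula in `M`. -/
def FormulaIn.zeroSet {tr : Trace M} {A : Set (TwoNormed tr)} (φ : FormulaIn A) :
    Set (Sort' tr 1) :=
  {x | φ.interp x = 0}

/-- `X ⊆ M_1` is a `φ`-definable subset of `M_1`: it is the zero set of `φ`, and every point
where `φ` is small is `‖·‖₂`-close to `X`. -/
def IsDefinableBy {tr : Trace M} {A : Set (TwoNormed tr)} (φ : FormulaIn A)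
    (X : Set (Sort' tr 1)) : Prop :=
  X = φ.zeroSet ∧ ∀ ε > (0 : ℝ), ∃ δ > (0 : ℝ), ∀ x : Sort' tr 1,
    φ.interp x < δ → Metric.infEDist x φ.zeroSet ≤ ENNReal.ofReal ε

/-! ### The formula `φ_N` -/

/-- The elements of `M` that belong to `N`. -/
def carrierIn (tr : Trace M) (N : VonNeumannAlgebra H) : Set (TwoNormed tr) := {x | op x ∈ N}

section phi

variable {tr : Trace M} {N : VonNeumannAlgebra H}

lemma opNorm_unitary (v : unitaries tr N) : opNorm v.1 ≤ ((1 : ℕ) : ℝ) := by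
  have h : star v.1 * v.1 = 1 := v.2.2.1
  have h1 : star (op v.1) * op v.1 = 1 := congrArg op h
  have h2 := CStarRing.norm_star_mul_self (x := op v.1)
  rw [h1] at h2
  have h3 : ‖(1 : H →L[ℂ] H)‖ ≤ 1 := ContinuousLinearMap.norm_id_le
  have h4 : 0 ≤ ‖op v.1‖ := norm_nonneg _
  rw [Nat.cast_one]
  show ‖op v.1‖ ≤ 1
  nlinarith

/-- The term `[x, v] = x v - v x`, for `v ∈ U(N)`. -/
def commTerm (v : unitaries tr N) : Term (carrierIn tr N) (fun _ : Fin 1 => 1) (1 * 1 + 1 * 1) :=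
  let x : Term (carrierIn tr N) (fun _ : Fin 1 => 1) 1 := .var 0
  let c : Term (carrierIn tr N) (fun _ : Fin 1 => 1) 1 := .param ⟨v.1, opNorm_unitary v⟩ v.2.1
  .add (.mul x c) (.smul (-1) (by simp) (.mul c x))

/-- The formula `‖[x, v]‖₂ = d([x, v], 0)`. -/
def commFormula (v : unitaries tr N) : Formula (carrierIn tr N) (fun _ : Fin 1 => 1) :=
  .dist (commTerm v) (.zero _)

/-- The formula `∑_{i < n} 2^{-i} ‖[x, u_i]‖₂`. -/
def partialFormula (u : ℕ → unitaries tr N) (n : ℕ) :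
    Formula (carrierIn tr N) (fun _ : Fin 1 => 1) :=
  .conn (m := n) ⟨fun r => ∑ i : Fin n, (2 : ℝ)⁻¹ ^ (i : ℕ) * r i, by fun_prop⟩
    fun i => commFormula (u i)

lemma commFormula_interp (v : unitaries tr N) (x : Sort' tr 1) :
    (commFormula v).interp (val1 x) = ‖x.1 * v.1 - v.1 * x.1‖ := by
  show Dist.dist (x.1 * v.1 + (-1 : ℂ) • (v.1 * x.1)) 0 = _
  rw [dist_zero_right, neg_one_smul, sub_eq_add_neg]

lemma partialFormula_interp (u : ℕ → unitaries tr N) (n : ℕ) (x : Sort' tr 1) :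
    (partialFormula u n).interp (val1 x) =
      ∑ i ∈ Finset.range n, (2 : ℝ)⁻¹ ^ i * ‖x.1 * (u i).1 - (u i).1 * x.1‖ := by
  rw [← Fin.sum_univ_eq_sum_range (fun i => (2 : ℝ)⁻¹ ^ i * ‖x.1 * (u i).1 - (u i).1 * x.1‖) n]
  show ∑ i : Fin n, (2 : ℝ)⁻¹ ^ (i : ℕ) * (commFormula (u i)).interp (val1 x) = _
  simp only [commFormula_interp]

lemma norm_comm_le (v : unitaries tr N) (x : Sort' tr 1) : ‖x.1 * v.1 - v.1 * x.1‖ ≤ 2 := by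
  have hx : opNorm x.1 ≤ 1 := by simpa using x.2
  have hv : opNorm v.1 ≤ 1 := by simpa using opNorm_unitary v
  have h0 := opNorm_nonneg x.1
  have h1 := opNorm_nonneg v.1
  have e1 := (norm_le_opNorm (x.1 * v.1)).trans (opNorm_mul _ _)
  have e2 := (norm_le_opNorm (v.1 * x.1)).trans (opNorm_mul _ _)
  have e3 := norm_sub_le (x.1 * v.1) (v.1 * x.1)
  nlinarith

lemma summable_phi (u : ℕ → unitaries tr N) (x : Sort' tr 1) :
    Summable fun i => (2 : ℝ)⁻¹ ^ i * ‖x.1 * (u i).1 - (u i).1 * x.1‖ := by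
  refine Summable.of_nonneg_of_le (fun i => by positivity)
    (fun i => mul_le_mul_of_nonneg_left (norm_comm_le (u i) x) (by positivity)) ?_
  exact (summable_geometric_of_lt_one (by norm_num) (by norm_num)).mul_right 2

lemma partialFormula_tail (u : ℕ → unitaries tr N) (K m : ℕ) (hm : K ≤ m) (x : Sort' tr 1) :
    |(partialFormula u m).interp (val1 x) - (partialFormula u K).interp (val1 x)|
      ≤ 4 * (2 : ℝ)⁻¹ ^ K := by
  rw [partialFormula_interp, partialFormula_interp]
  induction m, hm using Nat.le_induction with
  | base => simp
  | succ m hm _ =>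
    rw [← Finset.sum_Ico_eq_sub _ (Nat.le_succ_of_le hm),
      abs_of_nonneg (Finset.sum_nonneg fun i _ => by positivity)]
    calc _ ≤ ∑ i ∈ Finset.Ico K (m + 1), (2 : ℝ)⁻¹ ^ i * 2 :=
          Finset.sum_le_sum fun i _ =>
            mul_le_mul_of_nonneg_left (norm_comm_le (u i) x) (by positivity)
      _ = (∑ i ∈ Finset.Ico K (m + 1), (2 : ℝ)⁻¹ ^ i) * 2 := (Finset.sum_mul _ _ _).symm
      _ ≤ ((2 : ℝ)⁻¹ ^ K / (1 - 2⁻¹)) * 2 :=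
          mul_le_mul_of_nonneg_right
            (geom_sum_Ico_le_of_lt_one (by norm_num) (by norm_num)) (by norm_num)
      _ = _ := by ring

/-- The formula `φ_N(x) = ∑ₙ 2⁻ⁿ ‖[x, uₙ]‖₂` in `M` over `N`. -/
def phi (u : ℕ → unitaries tr N) : FormulaIn (carrierIn tr N) where
  seq := partialFormula u
  cauchy ε hε := by
    obtain ⟨K, hK⟩ := exists_pow_lt_of_lt_one (show 0 < ε / 8 by positivity)
      (show (2 : ℝ)⁻¹ < 1 by norm_num)
    refine ⟨K, fun m hm n hn x => ?_⟩
    have h1 := abs_le.1 (partialFormula_tail u K m hm x)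
    have h2 := abs_le.1 (partialFormula_tail u K n hn x)
    exact abs_le.2 ⟨by linarith, by linarith⟩

lemma phi_interp (u : ℕ → unitaries tr N) (x : Sort' tr 1) :
    (phi u).interp x = ∑' i, (2 : ℝ)⁻¹ ^ i * ‖x.1 * (u i).1 - (u i).1 * x.1‖ := by
  refine Filter.Tendsto.limUnder_eq ?_
  have := (summable_phi u x).hasSum.tendsto_sum_nat
  simp only [← partialFormula_interp] at this
  exact this

end phi

end TracialVN

end

namespace TracialVN

universe w

section CStarAlgebra

/-- Truncation of the polar decomposition `z = v|z|`: the element `z * f` is `v min(|z|, 1)`, and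
`k * k` is the positive part of `|z| - 1`. -/
lemma exists_unitBall_truncation {A : Type*} [CStarAlgebra A] (z : A) :
    ∃ f k : A, (∀ b, Commute (star z * z) b → Commute f b ∧ Commute k b) ∧ IsSelfAdjoint k ∧
      ‖z * f‖ ≤ 1 ∧ z - z * f = z * f * (k * k) ∧ star (z * f) * (z - z * f) = k * k := by
  have ha : IsSelfAdjoint (star z * z) := IsSelfAdjoint.star_mul_self z
  have hspec : ∀ t ∈ spectrum ℝ (star z * z), 0 ≤ t := spectrum_star_mul_self_nonneg
  set a := star z * z with ha_def
  let φ : ℝ → ℝ := fun t => (max 1 √t)⁻¹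
  let κ : ℝ → ℝ := fun t => √(√t * (1 - φ t))
  have hmax : ∀ t : ℝ, 0 < max 1 √t := fun t => lt_max_of_lt_left one_pos
  have hφ : Continuous φ :=
    (continuous_const.max Real.continuous_sqrt).inv₀ fun t => (hmax t).ne'
  have hκ : Continuous κ := by fun_prop
  have hκ2 : Continuous fun t => κ t * κ t := hκ.mul hκ
  have hφ1 : ∀ t, φ t ≤ 1 := fun t => inv_le_one_of_one_le₀ (le_max_left _ _)
  have hκκ : ∀ t, κ t * κ t = √t * (1 - φ t) := fun t =>
    Real.mul_self_sqrt (mul_nonneg (Real.sqrt_nonneg t) (sub_nonneg.2 (hφ1 t)))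
  have hφsqrt : ∀ t, φ t * √t * (1 - φ t) = 1 - φ t := fun t => by
    rcases le_total √t 1 with h | h
    · simp [φ, max_eq_left h]
    · have h0 : √t ≠ 0 := (one_pos.trans_le h).ne'
      simp [φ, max_eq_right h, h0]
  have hcφ : IsSelfAdjoint (cfc φ a) := IsSelfAdjoint.cfc
  have hcκ : IsSelfAdjoint (cfc κ a) := IsSelfAdjoint.cfc
  have hdiff : z - z * cfc φ a = z * cfc φ a * (cfc κ a * cfc κ a) := by
    have h1 : (1 : A) - cfc φ a = cfc φ a * (cfc κ a * cfc κ a) := by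
      rw [← cfc_mul κ κ a hκ.continuousOn hκ.continuousOn,
        ← cfc_mul φ (fun t => κ t * κ t) a hφ.continuousOn hκ2.continuousOn, ← cfc_const_one ℝ a,
        ← cfc_sub (fun _ => 1) φ a continuousOn_const hφ.continuousOn]
      exact cfc_congr fun t _ => by simp only [hκκ]; rw [← mul_assoc, hφsqrt]
    rw [mul_assoc, ← h1, mul_sub, mul_one]
  have hsq : star (z * cfc φ a) * (z * cfc φ a) = cfc (fun t => φ t * (t * φ t)) a := by
    rw [cfc_mul φ (fun t => t * φ t) a hφ.continuousOn (by fun_prop),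
      cfc_mul (fun t => t) φ a continuousOn_id hφ.continuousOn, cfc_id' ℝ a, star_mul,
      hcφ.star_eq, ha_def]
    simp only [mul_assoc]
  have hφφ : ∀ t, 0 ≤ t → φ t * (t * φ t) = (φ t * √t) ^ 2 := fun t ht => by
    rw [mul_pow, Real.sq_sqrt ht]; ring
  refine ⟨cfc φ a, cfc κ a, fun b hb => ⟨hb.cfc (ha.star_eq.symm ▸ hb) φ,
    hb.cfc (ha.star_eq.symm ▸ hb) κ⟩, hcκ, ?_, hdiff, ?_⟩
  · have h1 : ‖star (z * cfc φ a) * (z * cfc φ a)‖ ≤ 1 := by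
      rw [hsq]
      refine norm_cfc_le zero_le_one fun t ht => ?_
      have h2 : φ t * √t ≤ 1 := by
        rw [inv_mul_le_iff₀ (hmax t), mul_one]
        exact le_max_right _ _
      have h3 : 0 ≤ φ t * √t := mul_nonneg (inv_nonneg.2 (hmax t).le) (Real.sqrt_nonneg t)
      rw [hφφ t (hspec t ht), Real.norm_of_nonneg (sq_nonneg _)]
      exact pow_le_one₀ h3 h2
    rw [CStarRing.norm_star_mul_self] at h1
    nlinarith [norm_nonneg (z * cfc φ a)]
  · rw [hdiff, ← mul_assoc, hsq, ← cfc_mul κ κ a hκ.continuousOn hκ.continuousOn,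
      ← cfc_mul (fun t => φ t * (t * φ t)) (fun t => κ t * κ t) a (by fun_prop) hκ2.continuousOn]
    refine cfc_congr fun t ht => ?_
    simp only [hκκ, hφφ t (hspec t ht)]
    calc _ = √t * (φ t * √t * (φ t * √t * (1 - φ t))) := by ring
      _ = _ := by rw [hφsqrt, hφsqrt]

end CStarAlgebra

variable {H : Type w} [NormedAddCommGroup H] [InnerProductSpace ℂ H] [CompleteSpace H]
  {M N : VonNeumannAlgebra H} {tr : Trace M}

/-- A von Neumann algebra is a C⋆-algebra for the operator norm. -/
@[reducible] noncomputable def cstarAlgebra (M : VonNeumannAlgebra H) : CStarAlgebra M.toStarSubalgebra :=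
  { toCompleteSpace := (isClosed_coe M).completeSpace_coe
    norm_mul_self_le := fun x =>
      (CStarRing.norm_star_mul_self (x := (x : H →L[ℂ] H))).symm.le }

lemma mem_of_forall_commute {a : H →L[ℂ] H} (h : ∀ g ∈ M.commutant, Commute g a) : a ∈ M := by
  rw [← M.commutant_commutant, VonNeumannAlgebra.mem_commutant_iff]
  exact h

section TwoNorm

lemma trL_mul_comm (x y : TwoNormed tr) : trL tr (x * y) = trL tr (y * x) := tr.tracial' x y

lemma norm_sq_eq (x : TwoNormed tr) : ‖x‖ ^ 2 = (trL tr (star x * x)).re := by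
  rw [norm_eq, Real.sq_sqrt (Complex.nonneg_iff.1 (trL_nonneg x)).1]

lemma norm_star_eq (x : TwoNormed tr) : ‖star x‖ = ‖x‖ := by
  rw [norm_eq, norm_eq, star_star, trL_mul_comm]

lemma norm_mul_le_opNorm_mul (x y : TwoNormed tr) : ‖x * y‖ ≤ opNorm x * ‖y‖ := by
  let _ := cstarAlgebra M
  obtain ⟨b, hb⟩ := exists_star_mul_self_eq (A := M.toStarSubalgebra) x
  let b' : TwoNormed tr := b
  have hb' : ((opNorm x ^ 2 : ℝ) : ℂ) • (1 : TwoNormed tr) - star x * x = star b' * b' := hb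
  have h1 := (Complex.nonneg_iff.1 (trL_nonneg (tr := tr) (b' * y))).1
  have h2 : star (b' * y) * (b' * y) =
      ((opNorm x ^ 2 : ℝ) : ℂ) • (star y * y) - star (x * y) * (x * y) := by
    calc _ = star y * (star b' * b') * y := by
          rw [star_mul]; simp only [mul_assoc]
      _ = _ := by
          rw [← hb', mul_sub, sub_mul, star_mul, mul_smul_comm, mul_one, smul_mul_assoc]
          simp only [mul_assoc]
  rw [h2, map_sub, map_smul, smul_eq_mul, Complex.sub_re, Complex.re_ofReal_mul, ← norm_sq_eq,
    ← norm_sq_eq, sub_nonneg, ← mul_pow] at h1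
  exact le_of_sq_le_sq h1 (mul_nonneg (opNorm_nonneg x) (norm_nonneg y))

lemma norm_mul_le_mul_opNorm (x y : TwoNormed tr) : ‖x * y‖ ≤ ‖x‖ * opNorm y := by
  rw [← norm_star_eq, star_mul, ← norm_star_eq x, ← opNorm_star y, mul_comm]
  exact norm_mul_le_opNorm_mul _ _

/-- `‖[x, v]‖₂` is 2-Lipschitz in `v` for the 2-norm when `‖x‖ ≤ 1`. -/
lemma norm_commutator_le {x : TwoNormed tr} (hx : opNorm x ≤ 1) (v v' : TwoNormed tr) :
    ‖x * v - v * x‖ ≤ ‖x * v' - v' * x‖ + 2 * ‖v - v'‖ := by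
  have h1 := norm_mul_le_opNorm_mul x (v - v')
  have h2 := norm_mul_le_mul_opNorm (v - v') x
  have h3 : x * v - v * x = (x * v' - v' * x) + (x * (v - v') - (v - v') * x) := by noncomm_ring
  have h4 := norm_add_le (x * v' - v' * x) (x * (v - v') - (v - v') * x)
  have h5 := norm_sub_le (x * (v - v')) ((v - v') * x)
  rw [← h3] at h4
  nlinarith [norm_nonneg (v - v')]

lemma re_trL_mul_le {y k : TwoNormed tr} (hy : opNorm y ≤ 1) (hk : star k = k) :
    (trL tr (y * (k * k))).re ≤ (trL tr (k * k)).re := by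
  have h1 : trL tr (y * (k * k)) = inner ℂ k (y * k) := by
    rw [inner_eq, hk, ← mul_assoc, trL_mul_comm]
  have h2 : (trL tr (k * k)).re = ‖k‖ * ‖k‖ := by rw [← sq ‖k‖, norm_sq_eq, hk]
  rw [h1, h2]
  calc _ ≤ ‖k‖ * ‖y * k‖ := re_inner_le_norm (𝕜 := ℂ) k (y * k)
    _ ≤ ‖k‖ * ‖k‖ := mul_le_mul_of_nonneg_left
        ((norm_mul_le_opNorm_mul y k).trans (mul_le_of_le_one_left (norm_nonneg k) hy))
        (norm_nonneg k)

/-- Every element of `N' ∩ M` can be moved into the operator-norm unit ball of `N' ∩ M` without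
increasing its 2-distance to a given point of the unit ball of `M`. -/
lemma exists_relCommutant_unitBall_norm_sub_le {x z : TwoNormed tr} (hx : opNorm x ≤ 1)
    (hz : z ∈ relCommutant tr N) :
    ∃ y ∈ relCommutant tr N, opNorm y ≤ 1 ∧ ‖x - y‖ ≤ ‖x - z‖ := by
  obtain ⟨f, k, hcomm, hk, hnorm, hdiff, hmul⟩ := exists_unitBall_truncation (op z)
  have hzM : op z ∈ M := Subtype.property (p := fun y => y ∈ M.toStarSubalgebra) z
  have hM : ∀ g ∈ M.commutant, Commute (star (op z) * op z) g := fun g hg => by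
    rw [VonNeumannAlgebra.mem_commutant_iff] at hg
    exact hg _ (mul_mem (star_mem hzM) hzM)
  let f' : TwoNormed tr := (⟨f, mem_of_forall_commute fun g hg => (hcomm g (hM g hg)).1.symm⟩ :
    M.toStarSubalgebra)
  let k' : TwoNormed tr := (⟨k, mem_of_forall_commute fun g hg => (hcomm g (hM g hg)).2.symm⟩ :
    M.toStarSubalgebra)
  have hk' : star k' = k' := Subtype.ext hk
  have hdiff' : z - z * f' = z * f' * (k' * k') := Subtype.ext hdiff
  have hmul' : star (z * f') * (z - z * f') = k' * k' := Subtype.ext hmul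
  refine ⟨z * f', fun y hy => ?_, hnorm, ?_⟩
  · have h1 : z * y = y * z := hz y hy
    have h2 : star z * y = y * star z := by
      have hy' : op (star y) ∈ N := star_mem (s := N) hy
      have := congrArg star (hz (star y) hy')
      rw [star_mul, star_mul, star_star] at this
      exact this.symm
    have h3 : star z * z * y = y * (star z * z) := by rw [mul_assoc, h1, ← mul_assoc, h2, mul_assoc]
    have h4 : f' * y = y * f' := Subtype.ext (hcomm (op y) (congrArg op h3)).1
    rw [mul_assoc, h4, ← mul_assoc, h1, mul_assoc]
  · have h1 : (trL tr (star x * (z - z * f'))).re ≤ (trL tr (star (z * f') * (z - z * f'))).re := by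
      rw [hmul', hdiff', ← mul_assoc]
      refine re_trL_mul_le ?_ hk'
      refine (opNorm_mul _ _).trans (mul_le_one₀ ?_ (opNorm_nonneg _) hnorm)
      rwa [opNorm_star]
    have h2 : RCLike.re (inner ℂ (x - z * f') (z - z * f')) ≤ 0 := by
      rw [inner_sub_left, map_sub, sub_nonpos]
      exact h1
    have h3 := norm_sub_sq (𝕜 := ℂ) (x - z * f') (z - z * f')
    rw [sub_sub_sub_cancel_right] at h3
    refine le_of_sq_le_sq ?_ (norm_nonneg _)
    nlinarith [sq_nonneg ‖z - z * f'‖]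

end TwoNorm

section Projection

lemma coe_mem_L2Sub {Q : Submodule ℂ (TwoNormed tr)} {y : TwoNormed tr} (hy : y ∈ Q) :
    (y : L2 tr) ∈ L2Sub Q :=
  Submodule.le_topologicalClosure _ ⟨y, hy, rfl⟩

lemma norm_coe_sub_coe (x y : TwoNormed tr) : ‖(x : L2 tr) - (y : L2 tr)‖ = ‖x - y‖ := by
  rw [← UniformSpace.Completion.coe_sub, UniformSpace.Completion.norm_coe]

/-- `𝔼_Q(x)` is at least as close to `x` as any point of `Q`. -/
lemma norm_sub_condExp_le {Q : Submodule ℂ (TwoNormed tr)} {y : TwoNormed tr} (hy : y ∈ Q)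
    (x : TwoNormed tr) : ‖(x : L2 tr) - condExp Q (x : L2 tr)‖ ≤ ‖x - y‖ := by
  rw [condExp, Submodule.starProjection_minimal, ← norm_coe_sub_coe]
  exact ciInf_le (f := fun z : L2Sub Q => ‖(x : L2 tr) - z‖)
    ⟨0, by rintro _ ⟨z, rfl⟩; exact norm_nonneg _⟩ ⟨(y : L2 tr), coe_mem_L2Sub hy⟩

lemma exists_mem_norm_sub_lt {Q : Submodule ℂ (TwoNormed tr)} {x : TwoNormed tr} {r : ℝ}
    (h : ‖(x : L2 tr) - condExp Q (x : L2 tr)‖ < r) : ∃ y ∈ Q, ‖x - y‖ < r := by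
  have hmem : condExp Q (x : L2 tr) ∈ L2Sub Q := Submodule.starProjection_apply_mem _ _
  obtain ⟨_, ⟨y, hy, rfl⟩, hlt⟩ := Metric.mem_closure_iff.1 hmem _ (sub_pos.2 h)
  refine ⟨y, hy, ?_⟩
  rw [dist_eq_norm] at hlt
  change ‖condExp Q (x : L2 tr) - (y : L2 tr)‖ < _ at hlt
  rw [← norm_coe_sub_coe]
  have := norm_sub_le_norm_sub_add_norm_sub (x : L2 tr) (condExp Q (x : L2 tr)) (y : L2 tr)
  linarith

end Projection

/-- An element of `M` that commutes with `U(N)` lies in `N' ∩ M`. -/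
lemma mem_relCommutant_of_unitaries (hNM : N ≤ M) {x : TwoNormed tr}
    (h : ∀ v ∈ unitaries tr N, x * v = v * x) : x ∈ relCommutant tr N := by
  intro y hy
  let _ := cstarAlgebra N
  have hspan : (⟨op y, hy⟩ : N.toStarSubalgebra) ∈
      Submodule.span ℂ (unitary N.toStarSubalgebra : Set N.toStarSubalgebra) := by
    rw [CStarAlgebra.span_unitary]; trivial
  suffices H : ∀ b ∈ Submodule.span ℂ (unitary N.toStarSubalgebra : Set N.toStarSubalgebra),
      op x * (b : H →L[ℂ] H) = b * op x from Subtype.ext (H _ hspan)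
  intro b hb
  induction hb using Submodule.span_induction with
  | mem v hv =>
    let v' : TwoNormed tr := (⟨v.1, hNM v.2⟩ : M.toStarSubalgebra)
    have hv' : v' ∈ unitaries tr N :=
      ⟨v.2, Subtype.ext (congrArg Subtype.val hv.1 :), Subtype.ext (congrArg Subtype.val hv.2 :)⟩
    exact congrArg op (h v' hv')
  | zero => simp
  | add b c _ _ hb hc =>
    change op x * ((b : H →L[ℂ] H) + c) = (b + c) * op x
    rw [mul_add, add_mul, hb, hc]
  | smul r b _ hb =>
    change op x * (r • (b : H →L[ℂ] H)) = (r • (b : H →L[ℂ] H)) * op x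
    rw [mul_smul_comm, smul_mul_assoc, hb]

section Phi

lemma norm_commutator_le_phi (u : ℕ → unitaries tr N) (x : Sort' tr 1) (i : ℕ) :
    ‖x.1 * (u i).1 - (u i).1 * x.1‖ ≤ 2 ^ i * (phi u).interp x := by
  have h := (summable_phi u x).le_tsum i fun j _ => by positivity
  rw [← phi_interp, inv_pow, inv_mul_le_iff₀ (by positivity)] at h
  exact h

lemma opNorm_le_one (x : Sort' tr 1) : opNorm x.1 ≤ 1 := by simpa using x.2

/-- `φ_N` controls the commutator with any given unitary of `N`. -/
lemma exists_phi_lt_imp_norm_commutator_le {u : ℕ → unitaries tr N} (hu : DenseRange u)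
    (v : unitaries tr N) {δ : ℝ} (hδ : 0 < δ) :
    ∃ η > 0, ∀ x : Sort' tr 1, (phi u).interp x < η → ‖x.1 * v.1 - v.1 * x.1‖ ≤ δ := by
  obtain ⟨i, hi⟩ := hu.exists_dist_lt v (show 0 < δ / 4 by positivity)
  rw [Subtype.dist_eq, dist_eq_norm] at hi
  refine ⟨δ / 2 / 2 ^ i, by positivity, fun x hx => ?_⟩
  have h1 := norm_commutator_le (opNorm_le_one x) v.1 (u i).1
  have h2 := norm_commutator_le_phi u x i
  rw [lt_div_iff₀ (by positivity), mul_comm] at hx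
  linarith

lemma zeroSet_phi (hNM : N ≤ M) {u : ℕ → unitaries tr N} (hu : DenseRange u) :
    (phi u).zeroSet = {x : Sort' tr 1 | x.1 ∈ relCommutant tr N} := by
  ext x
  refine ⟨fun hx => mem_relCommutant_of_unitaries hNM fun v hv => ?_, fun hx => ?_⟩
  · have hx0 : (phi u).interp x = 0 := hx
    rw [← sub_eq_zero, ← norm_le_zero_iff]
    refine le_of_forall_pos_le_add fun δ hδ => ?_
    obtain ⟨η, hη, h⟩ := exists_phi_lt_imp_norm_commutator_le hu ⟨v, hv⟩ hδ
    rw [zero_add]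
    exact h x (hx0 ▸ hη)
  · change (phi u).interp x = 0
    rw [phi_interp]
    have : ∀ i, x.1 * (u i).1 - (u i).1 * x.1 = 0 := fun i => sub_eq_zero.2 (hx _ (u i).2.1)
    simp [this]

/-- `φ_N(x)` is small when the commutators of `x` with enough of the `uᵢ` are. -/
lemma exists_norm_commutator_le_imp_phi_lt (u : ℕ → unitaries tr N) {δ : ℝ} (hδ : 0 < δ) :
    ∃ K : ℕ, ∀ x : Sort' tr 1,
      (∀ i < K, ‖x.1 * (u i).1 - (u i).1 * x.1‖ ≤ δ / 8) → (phi u).interp x < δ := by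
  obtain ⟨K, hK⟩ := exists_pow_lt_of_lt_one (show 0 < δ / 8 by positivity)
    (show (2 : ℝ)⁻¹ < 1 by norm_num)
  refine ⟨K, fun x hx => ?_⟩
  have h1 : (phi u).interp x ≤ (partialFormula u K).interp (val1 x) + 4 * (2 : ℝ)⁻¹ ^ K := by
    refine le_of_tendsto ((phi u).tendsto_interp x) ?_
    filter_upwards [Filter.eventually_ge_atTop K] with m hm
    have := (abs_le.1 (partialFormula_tail u K m hm x)).2
    change (partialFormula u m).interp (val1 x) ≤ _
    linarith
  have h2 : (partialFormula u K).interp (val1 x) ≤ 2 * (δ / 8) := by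
    rw [partialFormula_interp]
    calc _ ≤ ∑ i ∈ Finset.range K, (2 : ℝ)⁻¹ ^ i * (δ / 8) :=
          Finset.sum_le_sum fun i hi =>
            mul_le_mul_of_nonneg_left (hx i (Finset.mem_range.1 hi)) (by positivity)
      _ = (∑ i ∈ Finset.range K, (2 : ℝ)⁻¹ ^ i) * (δ / 8) := (Finset.sum_mul _ _ _).symm
      _ ≤ _ := by
          refine mul_le_mul_of_nonneg_right ?_ (by positivity)
          have := (summable_geometric_of_lt_one (r := (2 : ℝ)⁻¹) (by norm_num)
            (by norm_num)).sum_le_tsum (Finset.range K) fun i _ => by positivity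
          rwa [tsum_geometric_inv_two] at this
  linarith

end Phi

lemma isDefinableBy_phi_of_hasWeakSpectralGap (hNM : N ≤ M) {u : ℕ → unitaries tr N}
    (hu : DenseRange u) (h : HasWeakSpectralGap tr N) :
    IsDefinableBy (phi u) {x : Sort' tr 1 | x.1 ∈ relCommutant tr N} := by
  refine ⟨(zeroSet_phi hNM hu).symm, fun ε hε => ?_⟩
  obtain ⟨F, hF, δ, hδ, hgap⟩ := h (ε / 2) (half_pos hε)
  choose! η hη hηF using fun (v : TwoNormed tr) (hv : v ∈ F) =>
    exists_phi_lt_imp_norm_commutator_le hu ⟨v, hF hv⟩ hδ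
  obtain ⟨η', hη', hle⟩ : ∃ η' > 0, ∀ v ∈ F, η' ≤ η v := by
    rcases F.eq_empty_or_nonempty with rfl | hne
    · exact ⟨1, one_pos, by simp⟩
    · obtain ⟨v₀, hv₀, hmin⟩ := F.exists_min_image η hne
      exact ⟨η v₀, hη v₀ hv₀, hmin⟩
  refine ⟨η', hη', fun x hx => ?_⟩
  have hx1 := hgap x.1 (opNorm_le_one x) fun v hv => hηF v hv x (hx.trans_le (hle v hv))
  obtain ⟨z, hz, hxz⟩ := exists_mem_norm_sub_lt (hx1.trans_lt (half_lt_self hε))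
  obtain ⟨y, hy, hy1, hxy⟩ :=
    exists_relCommutant_unitBall_norm_sub_le (opNorm_le_one x) hz
  rw [zeroSet_phi hNM hu]
  refine (Metric.infEDist_le_edist_of_mem (y := (⟨y, by simpa using hy1⟩ : Sort' tr 1)) hy).trans ?_
  rw [edist_dist, Subtype.dist_eq, dist_eq_norm]
  exact ENNReal.ofReal_le_ofReal (hxy.trans hxz.le)

lemma hasWeakSpectralGap_of_isDefinableBy_phi {u : ℕ → unitaries tr N}
    (h : IsDefinableBy (phi u) {x : Sort' tr 1 | x.1 ∈ relCommutant tr N}) :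
    HasWeakSpectralGap tr N := by
  classical
  obtain ⟨hX, hdef⟩ := h
  intro ε hε
  obtain ⟨δ, hδ, hφ⟩ := hdef (ε / 2) (half_pos hε)
  obtain ⟨K, hK⟩ := exists_norm_commutator_le_imp_phi_lt u hδ
  refine ⟨(Finset.range K).image fun i => (u i).1, ?_, δ / 8, by positivity, fun x hx hxF => ?_⟩
  · intro v hv
    obtain ⟨i, -, rfl⟩ := Finset.mem_image.1 (Finset.mem_coe.1 hv)
    exact (u i).2
  · let x' : Sort' tr 1 := ⟨x, by simpa using hx⟩
    have h1 := hφ x' (hK x' fun i hi =>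
      hxF _ (Finset.mem_image_of_mem (fun i => (u i).1) (Finset.mem_range.2 hi)))
    obtain ⟨y, hy, hxy⟩ := Metric.infEDist_lt_iff.1
      (h1.trans_lt ((ENNReal.ofReal_lt_ofReal_iff hε).2 (half_lt_self hε)))
    rw [← hX] at hy
    rw [edist_dist, ENNReal.ofReal_lt_ofReal_iff hε, Subtype.dist_eq, dist_eq_norm] at hxy
    exact (norm_sub_condExp_le hy x).trans hxy.le

end TracialVN

theorem mainTheorem7 {H : Type*} [NormedAddCommGroup H] [InnerProductSpace ℂ H] [CompleteSpace H]
    (M N : VonNeumannAlgebra H) (hM : TracialVN.IsII1Factor M) (tr : TracialVN.Trace M)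
    (hsep : TopologicalSpace.SeparableSpace (TracialVN.TwoNormed tr)) (hNM : N ≤ M)
    (u : ℕ → TracialVN.unitaries tr N) (hu : DenseRange u) :
    TracialVN.HasWeakSpectralGap tr N ↔
      TracialVN.IsDefinableBy (TracialVN.phi u)
        {x : TracialVN.Sort' tr 1 | x.1 ∈ TracialVN.relCommutant tr N} :=
  ⟨TracialVN.isDefinableBy_phi_of_hasWeakSpectralGap hNM hu,
    TracialVN.hasWeakSpectralGap_of_isDefinableBy_phi⟩
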